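/- Let $n\ge 3$ be an integer, let $\mu_0,\sigma_0\ge 0$, and define $\kappa>0$ by $\log(1+\kappa)=\frac{1}{2n(4n-1)}$. For samples $x=(x_1,\dots,x_n)\in\mathbb{R}^n$ put $$\widehat\mu_0=\frac1n\sum_{i=1}^n|x_i|,\qquad \widehat\sigma_\infty^2=\frac1n\sum_{i=1}^n x_i^2,\qquad \sigma_s^2=\widehat\sigma_\infty^2-\widehat\mu_0^2 ,$$ $$a=\begin{cases}50 & \text{if }\widehat\sigma_\infty^2\le(1+\kappa)\widehat\mu_0^2,\\[4pt] \dfrac{2(1+\kappa)\widehat\sigma_\infty^2}{\widehat\sigma_\infty^2-(1+\kappa)\widehat\mu_0^2} & \text{otherwise.}\end{cases}$$ The approximate joint maximum-likelihood estimates of variance and mean are $$\widehat\sigma_{a,ML}^2(x)=\begin{cases}\dfrac{a\,\widehat\sigma_\infty^2\,\sigma_s^2}{a\,\widehat\mu_0^2+2\widehat\sigma_\infty^2} & \text{if }\widehat\sigma_\infty^2\le\frac{2a}{a-2}\widehat\mu_0^2,\\[8pt] \widehat\sigma_\infty^2 & \text{otherwise,}\end{cases}\qquad \widehat\mu_{a,ML}(x)=\sqrt{\widehat\sigma_\infty^2-\widehat\sigma_{a,ML}^2(x)},$$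 with the convention $0/0=0$, which is needed only when $x=0$. Let $(M_k,\Sigma_k)_{k\ge0}$ be the recursive training process of the symmetric two-component Gaussian mixture with this estimator: $M_0=\mu_0$, $\Sigma_0=\sigma_0$, and for every $k\ge0$, conditionally on $(M_0,\Sigma_0),\dots,(M_k,\Sigma_k)$, the samples $X_{k+1,1},\dots,X_{k+1,n}$ are i.i.d. with law $\frac12N(-M_k,\Sigma_k^2)+\frac12N(M_k,\Sigma_k^2)$ (where $N(m,0)$ is the point mass at $m$), and $$M_{k+1}=\widehat\mu_{a,ML}(X_{k+1,1},\dots,X_{k+1,n}),\qquad \Sigma_{k+1}=\sqrt{\widehat\sigma_{a,ML}^2(X_{k+1,1},\dots,X_{k+1,n})} .$$ Then for every $k\ge0$ and every $\epsilon>0$, $$\Pr(\Sigma_k>\epsilon)\le\frac{\sigma_0}{\epsilon}\exp\left(-\frac{k}{4n}\right).$$ Moreover $\Sigma_k\to0$ almost surely as $k\to\infty$. -/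

import Mathlib

open MeasureTheory ProbabilityTheory Filter Topology

noncomputable section

/-- The symmetric two-component Gaussian mixture `½ N(-μ, σ²) + ½ N(μ, σ²)`.
(`gaussianReal m 0` is the point mass at `m`.) -/
def symmetricGMM (μ σ : ℝ) : Measure ℝ :=
  (2⁻¹ : ENNReal) • gaussianReal (-μ) (σ ^ 2).toNNReal +
    (2⁻¹ : ENNReal) • gaussianReal μ (σ ^ 2).toNNReal

/-- The absolute sample mean `μ̂₀ = (1/n) ∑ |xᵢ|`. -/
def absMean {n : ℕ} (x : Fin n → ℝ) : ℝ := (∑ i, |x i|) / n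

/-- The sample second moment `σ̂²_∞ = (1/n) ∑ xᵢ²`. -/
def secondMoment {n : ℕ} (x : Fin n → ℝ) : ℝ := (∑ i, x i ^ 2) / n

/-- The variance of the absolute values of the samples, `σ_s² = σ̂²_∞ - μ̂₀²`. -/
def absVariance {n : ℕ} (x : Fin n → ℝ) : ℝ := secondMoment x - absMean x ^ 2

/-- The constant `κ` with `log (1 + κ) = 1 / (2 n (4 n - 1))`. -/
def gmmKappa (n : ℕ) : ℝ := Real.exp (1 / (2 * (n : ℝ) * (4 * (n : ℝ) - 1))) - 1

/-- The parameter `a` selected by the approximate joint ML estimator. -/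
def approxMLParam {n : ℕ} (x : Fin n → ℝ) : ℝ :=
  if secondMoment x ≤ (1 + gmmKappa n) * absMean x ^ 2 then 50
  else 2 * (1 + gmmKappa n) * secondMoment x /
    (secondMoment x - (1 + gmmKappa n) * absMean x ^ 2)

/-- The approximate joint ML estimate of the variance. Its only possible division by zero is
`0 / 0`, when all samples vanish; the estimate is then `0`. -/
def approxMLVar {n : ℕ} (x : Fin n → ℝ) : ℝ :=
  if secondMoment x ≤ 2 * approxMLParam x / (approxMLParam x - 2) * absMean x ^ 2 then
    approxMLParam x * secondMoment x * absVariance x /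
      (approxMLParam x * absMean x ^ 2 + 2 * secondMoment x)
  else secondMoment x

/-- The approximate joint ML estimate of the standard deviation. -/
def approxMLStd {n : ℕ} (x : Fin n → ℝ) : ℝ := √(approxMLVar x)

/-- The approximate joint ML estimate of the mean. -/
def approxMLMean {n : ℕ} (x : Fin n → ℝ) : ℝ := √(secondMoment x - approxMLVar x)

/-- The recursive training process of the symmetric Gaussian mixture model with `n` samples in
each round and the approximate joint ML estimator, started from the parameters `μ₀`, `σ₀`.
`X (k + 1)` are the samples drawn from the model with parameters `M k`, `S k`, on which the
parameters `M (k + 1)`, `S (k + 1)` are trained; `X 0` plays no role. -/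
structure IsGMMRecursiveTraining {Ω : Type*} [MeasurableSpace Ω] (P : Measure Ω)
    [IsProbabilityMeasure P] (n : ℕ) (μ₀ σ₀ : ℝ)
    (X : ℕ → Ω → Fin n → ℝ) (M S : ℕ → Ω → ℝ) : Prop where
  measurable_samples : ∀ k, Measurable (X (k + 1))
  init_mean : ∀ ω, M 0 ω = μ₀
  init_std : ∀ ω, S 0 ω = σ₀
  /-- Given the parameters `(M i, S i)`, `i ≤ k`, the `n` samples of the next round are i.i.d.
  with law `½ N(-M k, S k ²) + ½ N(M k, S k ²)`. -/
  sample : ∀ k, ∀ᵐ ω ∂P,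
    condDistrib (X (k + 1)) (fun ω' (i : Fin (k + 1)) => (M i ω', S i ω')) P
        (fun i : Fin (k + 1) => (M i ω, S i ω)) =
      Measure.pi (fun _ : Fin n => symmetricGMM (M k ω) (S k ω))
  train_mean : ∀ k ω, M (k + 1) ω = approxMLMean (X (k + 1) ω)
  train_std : ∀ k ω, S (k + 1) ω = approxMLStd (X (k + 1) ω)

end

/-! ### Deterministic bounds on the estimator. -/

section Estimator

variable {n : ℕ}

/-! The expected standard deviation contracts by a fixed factor in each round, whatever the current
mean. Pointwise, the estimate is at most `1 + κ` times the empirical variance of the `|xᵢ|`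
(`approxMLVar_le`). That variance has expectation `(1 - 1/n) Var|X|`, and `Var|X| ≤ σ²` because
`|X|` has the same law under the mixture as under one Gaussian component. Jensen for the square root
then gives the factor `√((1 + κ)(1 - 1/n)) ≤ exp(-1/(4n))` (`lintegral_approxMLStd_le`). Iterating
through the conditional laws bounds `E Σ_k` geometrically; Markov's inequality gives the tail bound,
and summability of these expectations gives almost sure convergence. -/

lemma absMean_sq_le_secondMoment (x : Fin n → ℝ) : absMean x ^ 2 ≤ secondMoment x := by
  have h := sum_div_card_sq_le_sum_sq_div_card (s := (Finset.univ : Finset (Fin n)))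
    (f := fun i => |x i|)
  simpa [absMean, secondMoment] using h

lemma absVariance_nonneg (x : Fin n → ℝ) : 0 ≤ absVariance x :=
  sub_nonneg.2 (absMean_sq_le_secondMoment x)

lemma gmmKappa_pos (hn : 0 < n) : 0 < gmmKappa n := by
  have hn' : (1 : ℝ) ≤ n := by exact_mod_cast hn
  have : 0 < 1 / (2 * (n : ℝ) * (4 * (n : ℝ) - 1)) := by
    apply one_div_pos.2
    apply mul_pos <;> linarith
  have := Real.add_one_lt_exp this.ne'
  unfold gmmKappa
  linarith

/-- Ensures that samples with `a = 50` fall in the first branch of `approxMLVar`. -/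
lemma gmmKappa_le_one (hn : 0 < n) : gmmKappa n ≤ 1 := by
  have hn' : (1 : ℝ) ≤ n := by exact_mod_cast hn
  have h1 : 1 / (2 * (n : ℝ) * (4 * (n : ℝ) - 1)) ≤ 1 / 2 := by
    apply one_div_le_one_div_of_le (by norm_num)
    nlinarith
  have h2 : Real.exp (1 / 2) ≤ 2 := by
    have h : Real.exp (1 / 2) ^ 2 = Real.exp 1 := by
      rw [← Real.exp_nat_mul]; norm_num
    nlinarith [Real.exp_one_lt_d9, Real.exp_pos (1 / 2)]
  have := Real.exp_le_exp.2 h1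
  unfold gmmKappa
  linarith

/-- The approximate maximum-likelihood variance exceeds the variance of the absolute values
by a factor of at most `1 + κ`. -/
lemma approxMLVar_le (hn : 0 < n) (x : Fin n → ℝ) :
    approxMLVar x ≤ (1 + gmmKappa n) * absVariance x := by
  have hκ := gmmKappa_pos hn
  have hκ1 := gmmKappa_le_one hn
  have hv := absVariance_nonneg x
  have hle := absMean_sq_le_secondMoment x
  have hu := sq_nonneg (absMean x)
  have hvdef : absVariance x = secondMoment x - absMean x ^ 2 := rfl
  unfold approxMLVar approxMLParam
  generalize gmmKappa n = κ at *
  generalize absMean x ^ 2 = u at *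
  generalize secondMoment x = s at *
  generalize absVariance x = v at *
  by_cases h1 : s ≤ (1 + κ) * u
  · rw [if_pos h1]
    -- Here `1 + κ ≤ 2 < 100/48`.
    have hs : s ≤ 2 * 50 / (50 - 2) * u := by norm_num; nlinarith
    rw [if_pos hs]
    -- Only a nonnegative denominator is required, so the `0 / 0` case is included.
    apply div_le_of_le_mul₀ (by linarith) (by positivity)
    have : 50 * s ≤ (1 + κ) * (50 * u + 2 * s) := by nlinarith
    nlinarith
  · rw [if_neg h1]
    push Not at h1
    have hs : 0 < s := lt_of_le_of_lt (by positivity) h1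
    have hD : 0 < s - (1 + κ) * u := sub_pos.2 h1
    have hE : 0 < κ * s + (1 + κ) * u := by positivity
    have ha : 2 * (1 + κ) * s / (s - (1 + κ) * u) - 2 =
        2 * (κ * s + (1 + κ) * u) / (s - (1 + κ) * u) := by
      field_simp
      ring
    split_ifs with h2
    · apply le_of_eq
      field_simp
      ring
    · have h3 : 2 * (2 * (1 + κ) * s / (s - (1 + κ) * u)) /
          (2 * (1 + κ) * s / (s - (1 + κ) * u) - 2) * u =
          2 * (1 + κ) * s * u / (κ * s + (1 + κ) * u) := by
        rw [ha]
        field_simp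
      rw [h3, not_le, div_lt_iff₀ hE] at h2
      -- After cancelling `s`, failure of the branch condition reads `(1 + κ) u < κ s`, that is, `s
      -- < (1 + κ)(s - u)`.
      have h4 : 2 * (1 + κ) * u < κ * s + (1 + κ) * u := by
        refine lt_of_mul_lt_mul_left ?_ hs.le
        linarith
      rw [hvdef]
      nlinarith

@[fun_prop]
lemma measurable_absMean : Measurable (absMean (n := n)) := by
  unfold absMean
  fun_prop

@[fun_prop]
lemma measurable_secondMoment : Measurable (secondMoment (n := n)) := by
  unfold secondMoment
  fun_prop

@[fun_prop]
lemma measurable_approxMLParam : Measurable (approxMLParam (n := n)) := by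
  unfold approxMLParam
  refine Measurable.ite (measurableSet_le ?_ ?_) ?_ ?_ <;> fun_prop

@[fun_prop]
lemma measurable_approxMLVar : Measurable (approxMLVar (n := n)) := by
  unfold approxMLVar absVariance
  refine Measurable.ite (measurableSet_le ?_ ?_) ?_ ?_ <;> fun_prop

@[fun_prop]
lemma measurable_approxMLStd : Measurable (approxMLStd (n := n)) := by
  unfold approxMLStd
  fun_prop

@[fun_prop]
lemma measurable_approxMLMean : Measurable (approxMLMean (n := n)) := by
  unfold approxMLMean
  fun_prop

end Estimator

/-! ### Variance inequalities and the i.i.d. sample variance. -/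

section Variance

/-- Taking absolute values does not increase the variance. -/
lemma variance_abs_le {Ω : Type*} [MeasurableSpace Ω] {P : Measure Ω} [IsProbabilityMeasure P]
    {Y : Ω → ℝ} (hY : MemLp Y 2 P) : Var[fun ω => |Y ω|; P] ≤ Var[Y; P] := by
  rw [variance_eq_sub hY, variance_eq_sub (X := fun ω => |Y ω|) hY.abs]
  have h1 : |P[Y]| ≤ P[fun ω => |Y ω|] := abs_integral_le_integral_abs
  have h2 : P[Y] ^ 2 ≤ P[fun ω => |Y ω|] ^ 2 := sq_le_sq' (by linarith [neg_abs_le P[Y]])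
    ((le_abs_self _).trans h1)
  have h3 : P[(fun ω => |Y ω|) ^ 2] = P[Y ^ 2] := by simp
  rw [h3]
  linarith

/-- Jensen's inequality for the square root. -/
lemma integral_sqrt_le_sqrt_integral {Ω : Type*} [MeasurableSpace Ω] {P : Measure Ω}
    [IsProbabilityMeasure P] {f : Ω → ℝ} (hf : Integrable f P) (h0 : 0 ≤ f) :
    Integrable (fun ω => √(f ω)) P ∧ ∫ ω, √(f ω) ∂P ≤ √(∫ ω, f ω ∂P) := by
  have hsq : (fun ω => √(f ω)) ^ 2 = f := by
    ext ω
    exact Real.sq_sqrt (h0 ω)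
  have hL : MemLp (fun ω => √(f ω)) 2 P :=
    (memLp_two_iff_integrable_sq
      (Real.continuous_sqrt.comp_aestronglyMeasurable hf.aestronglyMeasurable)).2
      (by simpa [Real.sq_sqrt (h0 _)] using hf)
  refine ⟨hL.integrable one_le_two, Real.le_sqrt_of_sq_le ?_⟩
  -- Jensen here is nonnegativity of the variance of `√f`.
  have h := variance_nonneg (fun ω => √(f ω)) P
  rw [variance_eq_sub hL, hsq] at h
  linarith

/-- The expected empirical variance of the absolute values of an i.i.d. sample. -/
lemma integral_absVariance_pi {n : ℕ} (hn : 0 < n) {ν : Measure ℝ} [IsProbabilityMeasure ν]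
    (hν : MemLp (fun x : ℝ => |x|) 2 ν) :
    Integrable (absVariance (n := n)) (Measure.pi fun _ => ν) ∧
      ∫ x, absVariance x ∂(Measure.pi fun _ : Fin n => ν) =
        (1 - 1 / (n : ℝ)) * Var[fun x => |x|; ν] := by
  have hn0 : (n : ℝ) ≠ 0 := by exact_mod_cast hn.ne'
  have hmp : ∀ i, MeasurePreserving (Function.eval i) (Measure.pi fun _ : Fin n => ν) ν :=
    fun i => measurePreserving_eval (fun _ => ν) i
  have hL : ∀ i, MemLp (fun x : Fin n → ℝ => |x i|) 2 (Measure.pi fun _ => ν) :=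
    fun i => hν.comp_measurePreserving (hmp i)
  have hint : ∀ i, ∫ x : Fin n → ℝ, |x i| ∂(Measure.pi fun _ => ν) = ∫ x, |x| ∂ν := fun i =>
    integral_comp_eval (μ := fun _ : Fin n => ν) (i := i) hν.aestronglyMeasurable
  have hsq : ∀ i, Integrable (fun x : Fin n → ℝ => x i ^ 2) (Measure.pi fun _ => ν) := fun i => by
    simpa using (hL i).integrable_sq
  have hsqν : Integrable (fun x : ℝ => x ^ 2) ν := by simpa using hν.integrable_sq
  have hintsq : ∀ i, ∫ x : Fin n → ℝ, x i ^ 2 ∂(Measure.pi fun _ => ν) = ∫ x, x ^ 2 ∂ν := fun i =>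
    integral_comp_eval (μ := fun _ : Fin n => ν) (i := i) hsqν.aestronglyMeasurable
  have hS : Integrable (secondMoment (n := n)) (Measure.pi fun _ => ν) :=
    (integrable_finsetSum _ fun i _ => hsq i).div_const _
  have hSint : ∫ x, secondMoment x ∂(Measure.pi fun _ : Fin n => ν) = ∫ x, x ^ 2 ∂ν := by
    unfold secondMoment
    rw [integral_div, integral_finsetSum _ fun i _ => hsq i]
    simp only [hintsq, Finset.sum_const, Finset.card_univ, Fintype.card_fin, nsmul_eq_mul]
    field_simp
  have habs : absMean (n := n) = fun x => (n : ℝ)⁻¹ * (∑ i, fun x : Fin n → ℝ => |x i|) x := by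
    ext x
    simp [absMean, div_eq_inv_mul]
  have hA : MemLp (absMean (n := n)) 2 (Measure.pi fun _ => ν) := by
    rw [habs]
    exact (memLp_finsetSum' _ fun i _ => hL i).const_mul _
  have hAint : ∫ x, absMean x ∂(Measure.pi fun _ : Fin n => ν) = ∫ x, |x| ∂ν := by
    unfold absMean
    rw [integral_div, integral_finsetSum _ fun i _ => (hL i).integrable one_le_two]
    simp only [hint, Finset.sum_const, Finset.card_univ, Fintype.card_fin, nsmul_eq_mul]
    field_simp
  have hAvar : Var[absMean (n := n); Measure.pi fun _ => ν] =
      1 / (n : ℝ) * Var[fun x => |x|; ν] := by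
    rw [habs, variance_const_mul,
      variance_sum_pi (μ := fun _ : Fin n => ν) (X := fun _ x => |x|) fun _ => hν]
    simp only [Finset.sum_const, Finset.card_univ, Fintype.card_fin, nsmul_eq_mul]
    field_simp
  have hAsq : ∫ x, absMean x ^ 2 ∂(Measure.pi fun _ : Fin n => ν) =
      1 / (n : ℝ) * Var[fun x => |x|; ν] + (∫ x, |x| ∂ν) ^ 2 := by
    rw [← hAvar, variance_eq_sub hA, hAint]
    simp
  refine ⟨hS.sub hA.integrable_sq, ?_⟩
  have hV : Var[fun x => |x|; ν] = ∫ x, x ^ 2 ∂ν - (∫ x, |x| ∂ν) ^ 2 := by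
    rw [variance_eq_sub hν]
    simp
  unfold absVariance
  rw [integral_sub hS hA.integrable_sq, hSint, hAsq]
  linarith

end Variance

/-! ### One training round on the mixture. -/

section Mixture

instance isProbabilityMeasure_symmetricGMM (m s : ℝ) :
    IsProbabilityMeasure (symmetricGMM m s) := by
  constructor
  simp [symmetricGMM, ENNReal.inv_two_add_inv_two]

/-- The mixture and its Gaussian components have the same law up to sign. -/
lemma map_abs_symmetricGMM (m s : ℝ) :
    (symmetricGMM m s).map (fun x => |x|) =
      (gaussianReal m (s ^ 2).toNNReal).map (fun x => |x|) := by
  have h : (gaussianReal (-m) (s ^ 2).toNNReal).map (fun x => |x|) =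
      (gaussianReal m (s ^ 2).toNNReal).map (fun x => |x|) := by
    rw [← gaussianReal_map_neg, Measure.map_map (by fun_prop) (by fun_prop)]
    congr 1
    ext x
    simp
  rw [symmetricGMM, Measure.map_add _ _ (by fun_prop), Measure.map_smul, Measure.map_smul, h,
    ← add_smul, ENNReal.inv_two_add_inv_two, one_smul]

lemma memLp_abs_symmetricGMM (m s : ℝ) : MemLp (fun x : ℝ => |x|) 2 (symmetricGMM m s) := by
  have h : MemLp (fun x : ℝ => |x|) 2 (gaussianReal m (s ^ 2).toNNReal) :=
    (memLp_id_gaussianReal 2).abs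
  have hm : Measurable (fun x : ℝ => |x|) := by fun_prop
  have h1 := (memLp_map_measure_iff (g := id) (p := 2)
    aestronglyMeasurable_id hm.aemeasurable).2 h
  rw [← map_abs_symmetricGMM] at h1
  exact (memLp_map_measure_iff aestronglyMeasurable_id hm.aemeasurable).1 h1

/-- The bound is free of `m`, unlike the variance `s² + m²` of the mixture itself: `|x|` does not
see which component was drawn. -/
lemma variance_abs_symmetricGMM_le (m s : ℝ) :
    Var[fun x => |x|; symmetricGMM m s] ≤ s ^ 2 := by
  have hm : Measurable (fun x : ℝ => |x|) := by fun_prop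
  rw [← variance_id_map hm.aemeasurable, map_abs_symmetricGMM, variance_id_map hm.aemeasurable]
  refine (variance_abs_le (Y := id) (memLp_id_gaussianReal 2)).trans_eq ?_
  rw [variance_id_gaussianReal, Real.coe_toNNReal _ (sq_nonneg s)]

/-- After squaring, `1 - 1/n ≤ exp(-1/n)`, and the exponent of `1 + κ` is at most `1/(2n)`, which
costs at most half of that gain. -/
lemma gmm_contraction_factor_le {n : ℕ} (hn : 0 < n) :
    √((1 + gmmKappa n) * (1 - 1 / (n : ℝ))) ≤ Real.exp (-1 / (4 * (n : ℝ))) := by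
  have hn' : (1 : ℝ) ≤ n := by exact_mod_cast hn
  apply Real.sqrt_le_iff.2 ⟨(Real.exp_pos _).le, ?_⟩
  have h1 : 1 - 1 / (n : ℝ) ≤ Real.exp (-(1 / (n : ℝ))) := Real.one_sub_le_exp_neg _
  have h2 : 1 + gmmKappa n = Real.exp (1 / (2 * (n : ℝ) * (4 * (n : ℝ) - 1))) := by
    unfold gmmKappa; ring
  rw [h2, ← Real.exp_nat_mul]
  refine (mul_le_mul_of_nonneg_left h1 (Real.exp_pos _).le).trans ?_
  rw [← Real.exp_add, Real.exp_le_exp]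
  have h3 : 1 / (2 * (n : ℝ) * (4 * (n : ℝ) - 1)) ≤ 1 / (2 * n) :=
    one_div_le_one_div_of_le (by linarith) (by nlinarith)
  have h4 : ((2 : ℕ) : ℝ) * (-1 / (4 * (n : ℝ))) = 1 / (2 * n) - 1 / n := by
    field_simp
    norm_num
  rw [h4]
  linarith

/-- One round of training contracts the expected standard deviation. -/
lemma lintegral_approxMLStd_le {n : ℕ} (hn : 0 < n) (m : ℝ) {s : ℝ} (hs : 0 ≤ s) :
    ∫⁻ x, ENNReal.ofReal (approxMLStd x) ∂(Measure.pi fun _ : Fin n => symmetricGMM m s) ≤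
      ENNReal.ofReal (Real.exp (-1 / (4 * (n : ℝ)))) * ENNReal.ofReal s := by
  have hn' : (1 : ℝ) ≤ n := by exact_mod_cast hn
  have hκ := gmmKappa_pos hn
  have hn1 : 0 ≤ 1 - 1 / (n : ℝ) := sub_nonneg.2 ((div_le_one (by linarith)).2 hn')
  obtain ⟨hi, hv⟩ := integral_absVariance_pi hn (memLp_abs_symmetricGMM m s)
  obtain ⟨hi', hv'⟩ := integral_sqrt_le_sqrt_integral (hi.const_mul (1 + gmmKappa n))
    fun x => mul_nonneg (by linarith) (absVariance_nonneg x)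
  calc ∫⁻ x, ENNReal.ofReal (approxMLStd x) ∂(Measure.pi fun _ : Fin n => symmetricGMM m s)
      ≤ ∫⁻ x, ENNReal.ofReal √((1 + gmmKappa n) * absVariance x)
          ∂(Measure.pi fun _ : Fin n => symmetricGMM m s) :=
        lintegral_mono fun x => ENNReal.ofReal_le_ofReal (Real.sqrt_le_sqrt (approxMLVar_le hn x))
    _ = ENNReal.ofReal (∫ x, √((1 + gmmKappa n) * absVariance x)
          ∂(Measure.pi fun _ : Fin n => symmetricGMM m s)) :=
        (ofReal_integral_eq_lintegral_ofReal hi' (ae_of_all _ fun x => Real.sqrt_nonneg _)).symm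
    _ ≤ ENNReal.ofReal (Real.exp (-1 / (4 * (n : ℝ))) * s) := by
        apply ENNReal.ofReal_le_ofReal
        refine hv'.trans ?_
        rw [integral_const_mul, hv, ← mul_assoc]
        calc √((1 + gmmKappa n) * (1 - 1 / (n : ℝ)) * Var[fun x => |x|; symmetricGMM m s])
            ≤ √((1 + gmmKappa n) * (1 - 1 / (n : ℝ)) * s ^ 2) := by
              apply Real.sqrt_le_sqrt
              exact mul_le_mul_of_nonneg_left (variance_abs_symmetricGMM_le m s)
                (mul_nonneg (by linarith) hn1)
          _ = √((1 + gmmKappa n) * (1 - 1 / (n : ℝ))) * s := by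
              rw [Real.sqrt_mul (mul_nonneg (by linarith) hn1), Real.sqrt_sq hs]
          _ ≤ _ := mul_le_mul_of_nonneg_right (gmm_contraction_factor_le hn) hs
    _ = _ := ENNReal.ofReal_mul (Real.exp_pos _).le

end Mixture

/-! ### The recursion, by conditioning on the past. -/

/-- Integration of a function of `Y` by conditioning on `Z`. -/
lemma lintegral_comp_eq_lintegral_condDistrib {Ω α β : Type*} [MeasurableSpace Ω]
    [MeasurableSpace α] [MeasurableSpace β] [StandardBorelSpace β] [Nonempty β] {P : Measure Ω}
    [IsFiniteMeasure P] {Z : Ω → α} {Y : Ω → β} (hZ : Measurable Z) (hY : Measurable Y)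
    {f : β → ENNReal} (hf : Measurable f) :
    ∫⁻ ω, f (Y ω) ∂P = ∫⁻ ω, ∫⁻ y, f y ∂(condDistrib Y Z P (Z ω)) ∂P := by
  have h1 := Measure.lintegral_compProd (μ := P.map Z) (κ := condDistrib Y Z P)
    (f := fun p => f p.2) (by fun_prop)
  rw [compProd_map_condDistrib hY.aemeasurable,
    lintegral_map (by fun_prop) (by fun_prop)] at h1
  rw [h1, lintegral_map (hf.lintegral_kernel) hZ]

namespace IsGMMRecursiveTraining

variable {Ω : Type*} [MeasurableSpace Ω] {P : Measure Ω} [IsProbabilityMeasure P]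
  {n : ℕ} {μ₀ σ₀ : ℝ} {X : ℕ → Ω → Fin n → ℝ} {M S : ℕ → Ω → ℝ}

lemma measurable_mean (h : IsGMMRecursiveTraining P n μ₀ σ₀ X M S) (k : ℕ) :
    Measurable (M k) := by
  cases k with
  | zero =>
    rw [show M 0 = fun _ => μ₀ from funext h.init_mean]
    exact measurable_const
  | succ k =>
    rw [show M (k + 1) = fun ω => approxMLMean (X (k + 1) ω) from funext (h.train_mean k)]
    exact measurable_approxMLMean.comp (h.measurable_samples k)

lemma measurable_std (h : IsGMMRecursiveTraining P n μ₀ σ₀ X M S) (k : ℕ) :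
    Measurable (S k) := by
  cases k with
  | zero =>
    rw [show S 0 = fun _ => σ₀ from funext h.init_std]
    exact measurable_const
  | succ k =>
    rw [show S (k + 1) = fun ω => approxMLStd (X (k + 1) ω) from funext (h.train_std k)]
    exact measurable_approxMLStd.comp (h.measurable_samples k)

lemma std_nonneg (h : IsGMMRecursiveTraining P n μ₀ σ₀ X M S) (hσ₀ : 0 ≤ σ₀) (k : ℕ) (ω : Ω) :
    0 ≤ S k ω := by
  cases k with
  | zero => rwa [h.init_std]
  | succ k =>
    rw [h.train_std]
    exact Real.sqrt_nonneg _

lemma lintegral_std_succ_le (h : IsGMMRecursiveTraining P n μ₀ σ₀ X M S) (hn : 0 < n)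
    (hσ₀ : 0 ≤ σ₀) (k : ℕ) :
    ∫⁻ ω, ENNReal.ofReal (S (k + 1) ω) ∂P ≤
      ENNReal.ofReal (Real.exp (-1 / (4 * (n : ℝ)))) * ∫⁻ ω, ENNReal.ofReal (S k ω) ∂P := by
  have hZ : Measurable fun ω (i : Fin (k + 1)) => (M i ω, S i ω) :=
    measurable_pi_lambda _ fun i => (h.measurable_mean i).prodMk (h.measurable_std i)
  simp_rw [h.train_std k]
  rw [lintegral_comp_eq_lintegral_condDistrib hZ (h.measurable_samples k)
      (f := fun x => ENNReal.ofReal (approxMLStd x)) (by fun_prop),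
    ← lintegral_const_mul _ (h.measurable_std k).ennreal_ofReal]
  refine lintegral_mono_ae ?_
  filter_upwards [h.sample k] with ω hω
  rw [hω]
  exact lintegral_approxMLStd_le hn _ (h.std_nonneg hσ₀ k ω)

lemma lintegral_std_le (h : IsGMMRecursiveTraining P n μ₀ σ₀ X M S) (hn : 0 < n)
    (hσ₀ : 0 ≤ σ₀) (k : ℕ) :
    ∫⁻ ω, ENNReal.ofReal (S k ω) ∂P ≤
      ENNReal.ofReal (Real.exp (-1 / (4 * (n : ℝ)))) ^ k * ENNReal.ofReal σ₀ := by
  induction k with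
  | zero => simp [h.init_std]
  | succ k ih =>
    refine (h.lintegral_std_succ_le hn hσ₀ k).trans ?_
    rw [pow_succ', mul_assoc]
    gcongr

end IsGMMRecursiveTraining

theorem theorem4 {Ω : Type*} [MeasurableSpace Ω] (P : Measure Ω) [IsProbabilityMeasure P]
    (n : ℕ) (hn : 3 ≤ n) (μ₀ σ₀ : ℝ) (hμ₀ : 0 ≤ μ₀) (hσ₀ : 0 ≤ σ₀)
    (X : ℕ → Ω → Fin n → ℝ) (M S : ℕ → Ω → ℝ)
    (h : IsGMMRecursiveTraining P n μ₀ σ₀ X M S) :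
    (∀ (k : ℕ) (ε : ℝ), 0 < ε →
      P.real {ω | ε < S k ω} ≤ σ₀ / ε * Real.exp (-(k : ℝ) / (4 * (n : ℝ)))) ∧
    (∀ᵐ ω ∂P, Tendsto (fun k => S k ω) atTop (𝓝 0)) := by
  have hn0 : 0 < n := by omega
  have hbound := h.lintegral_std_le hn0 hσ₀
  constructor
  · intro k ε hε
    have h1 : ENNReal.ofReal ε * P {ω | ε < S k ω} ≤ ENNReal.ofReal
        (Real.exp (-1 / (4 * (n : ℝ))) ^ k * σ₀) := by
      rw [ENNReal.ofReal_mul (by positivity), ENNReal.ofReal_pow (by positivity)]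
      refine le_trans ?_ (hbound k)
      refine le_trans ?_ (mul_meas_ge_le_lintegral (h.measurable_std k).ennreal_ofReal
        (ENNReal.ofReal ε))
      gcongr
      exact fun hω => ENNReal.ofReal_le_ofReal hω.le
    have h2 := ENNReal.toReal_mono ENNReal.ofReal_ne_top h1
    rw [ENNReal.toReal_mul, ENNReal.toReal_ofReal hε.le, ENNReal.toReal_ofReal (by positivity),
      ← Real.exp_nat_mul] at h2
    have h3 : (k : ℝ) * (-1 / (4 * (n : ℝ))) = -(k : ℝ) / (4 * (n : ℝ)) := by ring
    rw [h3] at h2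
    rw [div_mul_eq_mul_div, le_div_iff₀ hε, mul_comm, mul_comm σ₀]
    exact h2
  · have hr : ENNReal.ofReal (Real.exp (-1 / (4 * (n : ℝ)))) < 1 := by
      rw [ENNReal.ofReal_lt_one, Real.exp_lt_one_iff]
      have : (0 : ℝ) < n := by exact_mod_cast hn0
      exact div_neg_of_neg_of_pos (by norm_num) (by positivity)
    -- By Tonelli and the geometric bound, `∑ Σ_k` has finite expectation; it is then almost surely
    -- finite and its terms tend to `0`.
    have hsum : ∫⁻ ω, ∑' k, ENNReal.ofReal (S k ω) ∂P ≠ ⊤ := by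
      rw [lintegral_tsum fun k => (h.measurable_std k).ennreal_ofReal.aemeasurable]
      refine ne_top_of_le_ne_top ?_ (ENNReal.tsum_le_tsum hbound)
      rw [ENNReal.tsum_mul_right, ENNReal.tsum_geometric]
      exact ENNReal.mul_ne_top (ENNReal.inv_ne_top.2 (tsub_pos_of_lt hr).ne') ENNReal.ofReal_ne_top
    filter_upwards [ae_lt_top (Measurable.tsum fun k => (h.measurable_std k).ennreal_ofReal)
      hsum] with ω hω
    have h1 := (ENNReal.tendsto_toReal ENNReal.zero_ne_top).comp
      (ENNReal.tendsto_atTop_zero_of_tsum_ne_top hω.ne)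
    simpa [Function.comp_def, ENNReal.toReal_ofReal (h.std_nonneg hσ₀ _ ω)] using h1
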